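/- **Model.** An instance $\mathcal I=(E,\mathcal D,\mathcal F)$ consists of a finite ground set $E$ with $n=|E|$, a probability distribution $D_e$ on $[0,\infty)$ for every $e\in E$, and a nonempty family $\mathcal F\subseteq 2^E$ of feasible sets, not necessarily downward-closed. The values $v_e\sim D_e$ are drawn independently. The instance is *binary* if the support of every $D_e$ is $\{0,1\}$. The elements arrive one by one in some order $\pi$; upon the arrival of $e$, its identity and its value $v_e$ are revealed, and a (deterministic or randomized) algorithm irrevocably decides whether to select $e$. For every arrival order the set selected in the end must (almost surely) belong to $\mathcal F$. The utility is the sum of the values of the selected elements, and $ALG(\pi)$ denotes the expected utility of the algorithm $ALG$ under the arrival order $\pi$. An algorithm is *order-unaware* if each decision depends only on its internal randomness and on the identities and values of the elements that have arrived so far; an *order-aware* algorithm may in addition use the whole order $\pi$ from the start. Let $OPT_{\mathcal I,\pi}(\pi)$ be the largest (supremum) expected utility of an order-aware algorithm under $\pi$, and define the order-competitive ratio $$\rho(\mathcal I,ALG)=\min_{\pi}\frac{ALG(\pi)}{OPT_{\mathcal I,\pi}(\pi)},$$ which is meaningful if $0<OPT_{\mathcal I,\pi}(\pi)<\infty$ for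 every arrival order $\pi$. **Theorem.** 1. For every constant $\xi>1$ there exists $n_0$ such that for every $n\ge n_0$ there is a binary instance $\mathcal I=(E,\mathcal D,\mathcal F)$ with $|E|=n$, with $\mathcal F$ not downward-closed and with $0<OPT_{\mathcal I,\pi}(\pi)<\infty$ for every arrival order $\pi$, such that every (deterministic or randomized) order-unaware algorithm $ALG$ satisfies $$\rho(\mathcal I,ALG)\le\frac{\xi}{n}.$$ 2. This is tight: for every instance $\mathcal I=(E,\mathcal D,\mathcal F)$ with $n=|E|$ elements (binary or not) such that $0<OPT_{\mathcal I,\pi}(\pi)<\infty$ for every arrival order $\pi$, there is an order-unaware algorithm $ALG$ with $\rho(\mathcal I,ALG)\ge\frac1n$. -/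

import Mathlib

open MeasureTheory
open scoped NNReal ENNReal

/-- An instance `(E, D, F)`: every element `e` of the finite ground set `E` carries a probability
distribution `dist e` of its (nonnegative) value, and `feasible` is the nonempty family of
feasible sets. -/
structure SelectionInstance (E : Type) [Fintype E] where
  dist : E → Measure ℝ≥0
  isProb : ∀ e, IsProbabilityMeasure (dist e)
  feasible : Set (Finset E)
  feasible_nonempty : feasible.Nonempty

/-- An arrival order: `π t` is the element that arrives at time `t`. -/
abbrev ArrivalOrder (E : Type) [Fintype E] : Type := Fin (Fintype.card E) ≃ E

namespace SelectionInstance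

variable {E : Type} [Fintype E]

/-- The instance is binary: every value distribution has support `{0, 1}`. -/
def IsBinary (I : SelectionInstance E) : Prop :=
  ∀ e, (I.dist e).support = {0, 1}

/-- Every subset of a feasible set is feasible. -/
def IsDownwardClosed (I : SelectionInstance E) : Prop :=
  ∀ S ∈ I.feasible, ∀ T, T ⊆ S → T ∈ I.feasible

/-- The joint law of the values, which are drawn independently. -/
noncomputable def valueLaw (I : SelectionInstance E) : Measure (E → ℝ≥0) :=
  Measure.pi I.dist

/-- A (possibly randomized) online algorithm that may know the arrival order in advance.
The internal randomness is a seed drawn independently of the values; `select ω π v` is the set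
selected in the end when the seed is `ω`, the arrival order is `π` and the values are `v`. -/
structure Algorithm (I : SelectionInstance E) where
  Seed : Type
  seedSpace : MeasurableSpace Seed
  seedLaw : Measure Seed
  seedLaw_isProb : IsProbabilityMeasure seedLaw
  select : Seed → ArrivalOrder E → (E → ℝ≥0) → Finset E
  measurable_select : ∀ (π : ArrivalOrder E) (e : E),
    MeasurableSet {x : Seed × (E → ℝ≥0) | e ∈ select x.1 π x.2}
  /-- The decision at time `t` depends only on the seed, the order, and the values of the elements
  that have arrived up to time `t`. -/
  online : ∀ (ω : Seed) (π : ArrivalOrder E) (v v' : E → ℝ≥0) (t : Fin (Fintype.card E)),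
    (∀ s ≤ t, v (π s) = v' (π s)) → (π t ∈ select ω π v ↔ π t ∈ select ω π v')
  /-- For every arrival order the set selected in the end is feasible, almost surely. -/
  select_feasible : ∀ π : ArrivalOrder E,
    ∀ᵐ x ∂(seedLaw.prod I.valueLaw), select x.1 π x.2 ∈ I.feasible

namespace Algorithm

variable {I : SelectionInstance E}

attribute [instance] Algorithm.seedSpace

/-- The algorithm does not know the arrival order: the decision at time `t` depends only on the
seed and on the identities and values of the elements that have arrived up to time `t`. -/
def IsOrderUnaware (A : I.Algorithm) : Prop :=
  ∀ (ω : A.Seed) (π π' : ArrivalOrder E) (v v' : E → ℝ≥0) (t : Fin (Fintype.card E)),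
    (∀ s ≤ t, π s = π' s ∧ v (π s) = v' (π s)) →
      (π t ∈ A.select ω π v ↔ π t ∈ A.select ω π' v')

/-- The expected sum of the values of the selected elements under the arrival order `π`. -/
noncomputable def expectedUtility (A : I.Algorithm) (π : ArrivalOrder E) : ℝ≥0∞ :=
  ∫⁻ x, ∑ e ∈ A.select x.1 π x.2, (x.2 e : ℝ≥0∞) ∂(A.seedLaw.prod I.valueLaw)

end Algorithm

/-- The optimal expected utility of an algorithm that knows that the arrival order is `π`. -/
noncomputable def opt (I : SelectionInstance E) (π : ArrivalOrder E) : ℝ≥0∞ :=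
  ⨆ A : I.Algorithm, A.expectedUtility π

/-- The benchmark is positive and finite for every arrival order, so that the quotients in the
order-competitive ratio are meaningful. -/
def HasProperBenchmark (I : SelectionInstance E) : Prop :=
  ∀ π : ArrivalOrder E, 0 < I.opt π ∧ I.opt π < ∞

/-- The worst case, over the finitely many arrival orders, of the ratio between the expected
utility of the algorithm and the order-aware optimum. -/
noncomputable def Algorithm.orderCompetitiveRatio {I : SelectionInstance E} (A : I.Algorithm) :
    ℝ≥0∞ :=
  ⨅ π : ArrivalOrder E, A.expectedUtility π / I.opt π

end SelectionInstance

/-! Hardness comes from a hidden bit string x that only the arrival order reveals. Password elements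
arrive first; then come the signature blocks (i, x i, ·), the valuable elements, and the opposite
blocks. Taking a valuable element h forces the blocks opposite to the chosen password to spell `code
h`. Knowing the order, one chooses x itself, so all forced blocks come late and the first nonzero
valuable element can be taken, for a gain of about mp (`le_opt_twistedOrder`). An order-unaware
algorithm fixes its password before the orders for different x can be told apart
(`password_mem_select_twistedOrder`). At a wrong position, an early block already commits to a
codeword, so at most one valuable element stays available, worth p
(`mem_passwordEvent_or_decodeEvent`, `expectedUtility_twistedOrder_le`). Correct guesses of
different x are disjoint events, so together they add at most mp over all 2^k orders
(`sum_expectedUtility_le`). On average this is about p against mp, with m = n - O(log² n). For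
tightness, a fixed feasible set through a selectable element of largest mean earns at least 1/n of
the sum of the selectable means, which bounds every algorithm. -/

namespace SelectionInstance

/-! ### Independence of values, and the 1/n guarantee -/

section General

variable {E : Type} [Fintype E] (I : SelectionInstance E)

instance (e : E) : IsProbabilityMeasure (I.dist e) := I.isProb e

instance : IsProbabilityMeasure I.valueLaw :=
  inferInstanceAs (IsProbabilityMeasure (Measure.pi I.dist))

instance (A : I.Algorithm) : IsProbabilityMeasure A.seedLaw := A.seedLaw_isProb

/-- The expected value of the element `e`. -/
noncomputable def meanValue (e : E) : ℝ≥0∞ := ∫⁻ a, (a : ℝ≥0∞) ∂I.dist e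

/-- A function that does not depend on the coordinate `e` is independent of the value of `e`. -/
lemma lintegral_value_mul (e : E) (f : (E → ℝ≥0) → ℝ≥0∞) (hf : Measurable f)
    (hfe : ∀ v w : E → ℝ≥0, (∀ e', e' ≠ e → v e' = w e') → f v = f w) :
    ∫⁻ v, (v e : ℝ≥0∞) * f v ∂I.valueLaw = I.meanValue e * ∫⁻ v, f v ∂I.valueLaw := by
  classical
  rw [← lintegral_const_mul _ hf]
  have hm : Measurable fun v : E → ℝ≥0 => (v e : ℝ≥0∞) :=
    measurable_coe_nnreal_ennreal.comp (measurable_pi_apply e)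
  refine lintegral_eq_of_lmarginal_eq {e} (hm.mul hf) (hf.const_mul _) ?_
  have hupd : ∀ (v : E → ℝ≥0) a, f (Function.update v e a) = f v := fun v a =>
    hfe _ _ fun e' he' => Function.update_of_ne he' _ _
  simp only [lmarginal_singleton, hupd, Function.update_self]
  funext v
  rw [lintegral_mul_const _ measurable_coe_nnreal_ennreal, lintegral_const, measure_univ, mul_one]
  rfl

lemma lintegral_value (e : E) : ∫⁻ v, (v e : ℝ≥0∞) ∂I.valueLaw = I.meanValue e := by
  simpa using I.lintegral_value_mul e (fun _ => 1) measurable_const fun _ _ _ => rfl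

lemma lintegral_value_mul_indicator {Ω : Type} [MeasurableSpace Ω] (μ : Measure Ω)
    [IsProbabilityMeasure μ] (e : E) (B : Set (Ω × (E → ℝ≥0))) (hB : MeasurableSet B)
    (hBe : ∀ ω, ∀ v w : E → ℝ≥0, (∀ e', e' ≠ e → v e' = w e') → ((ω, v) ∈ B ↔ (ω, w) ∈ B)) :
    ∫⁻ x, (x.2 e : ℝ≥0∞) * B.indicator 1 x ∂(μ.prod I.valueLaw) =
      I.meanValue e * (μ.prod I.valueLaw) B := by
  have hm : Measurable fun x : Ω × (E → ℝ≥0) => (x.2 e : ℝ≥0∞) :=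
    measurable_coe_nnreal_ennreal.comp ((measurable_pi_apply e).comp measurable_snd)
  have hi : Measurable (B.indicator (1 : Ω × (E → ℝ≥0) → ℝ≥0∞)) := measurable_one.indicator hB
  rw [← lintegral_indicator_one hB, lintegral_prod (fun x : Ω × (E → ℝ≥0) => (x.2 e : ℝ≥0∞) * B.indicator 1 x)
    (hm.mul hi).aemeasurable, lintegral_prod _ hi.aemeasurable, ← lintegral_const_mul _ hi.lintegral_prod_right']
  refine lintegral_congr fun ω => ?_
  refine I.lintegral_value_mul e _ (hi.comp measurable_prodMk_left) fun v w h => ?_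
  by_cases hv : (ω, v) ∈ B
  · simp [hv, (hBe ω v w h).1 hv]
  · simp [hv, mt (hBe ω v w h).2 hv]

lemma lintegral_prod_value {Ω : Type} [MeasurableSpace Ω] (μ : Measure Ω)
    [IsProbabilityMeasure μ] (e : E) :
    ∫⁻ x, (x.2 e : ℝ≥0∞) ∂(μ.prod I.valueLaw) = I.meanValue e := by
  simpa using I.lintegral_value_mul_indicator μ e Set.univ .univ (by simp)

/-- Elements outside `U` are never selected if every feasible set is contained in `U`. -/
lemma Algorithm.expectedUtility_le_sum {I : SelectionInstance E} (A : I.Algorithm)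
    (U : Finset E) (hU : ∀ S ∈ I.feasible, S ⊆ U) (π : ArrivalOrder E) :
    A.expectedUtility π ≤ ∑ e ∈ U, I.meanValue e := by
  calc A.expectedUtility π
      ≤ ∫⁻ x, ∑ e ∈ U, (x.2 e : ℝ≥0∞) ∂(A.seedLaw.prod I.valueLaw) := by
        refine lintegral_mono_ae ?_
        filter_upwards [A.select_feasible π] with x hx
        exact Finset.sum_le_sum_of_subset (hU _ hx)
    _ = ∑ e ∈ U, I.meanValue e := by
        rw [lintegral_finsetSum]
        · simp_rw [lintegral_prod_value]
        · exact fun e _ =>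
            measurable_coe_nnreal_ennreal.comp ((measurable_pi_apply e).comp measurable_snd)

/-- The algorithm that always selects the feasible set `S`. -/
noncomputable def constantAlgorithm (S : Finset E) (hS : S ∈ I.feasible) : I.Algorithm where
  Seed := Unit
  seedSpace := inferInstance
  seedLaw := Measure.dirac ()
  seedLaw_isProb := inferInstance
  select _ _ _ := S
  measurable_select _ _ := .const _
  online _ _ _ _ _ _ := Iff.rfl
  select_feasible _ := .of_forall fun _ => hS

lemma constantAlgorithm_isOrderUnaware (S : Finset E) (hS : S ∈ I.feasible) :
    (I.constantAlgorithm S hS).IsOrderUnaware := by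
  intro ω π π' v v' t h
  rw [(h t le_rfl).1]
  rfl

lemma meanValue_le_constantAlgorithm (S : Finset E) (hS : S ∈ I.feasible) {e : E} (he : e ∈ S)
    (π : ArrivalOrder E) : I.meanValue e ≤ (I.constantAlgorithm S hS).expectedUtility π := by
  rw [← I.lintegral_prod_value (Measure.dirac ()) e]
  exact lintegral_mono fun x =>
    Finset.single_le_sum (f := fun e => (x.2 e : ℝ≥0∞)) (fun _ _ => zero_le) he

/-- Always selecting a feasible set that contains an element of largest mean is
`1/n`-competitive. -/
theorem exists_orderUnaware_inv_card_le (h : I.HasProperBenchmark) :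
    ∃ A : I.Algorithm, A.IsOrderUnaware ∧
      1 / (Fintype.card E : ℝ≥0∞) ≤ A.orderCompetitiveRatio := by
  classical
  -- The maximum is taken over `U` only: an element in no feasible set may have a large mean but can
  -- never be collected.
  let U : Finset E := Finset.univ.filter fun e => ∃ S ∈ I.feasible, e ∈ S
  have hU : ∀ S ∈ I.feasible, S ⊆ U := fun S hS e he =>
    Finset.mem_filter.2 ⟨Finset.mem_univ _, S, hS, he⟩
  have hopt : ∀ π, I.opt π ≤ ∑ e ∈ U, I.meanValue e := fun π =>
    iSup_le fun A => A.expectedUtility_le_sum U hU π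
  have hne : U.Nonempty := by
    by_contra hemp
    rw [Finset.not_nonempty_iff_eq_empty] at hemp
    have := (h (Fintype.equivFin E).symm).1.trans_le (hopt _)
    simp [hemp] at this
  obtain ⟨e, heU, hmax⟩ := U.exists_max_image I.meanValue hne
  obtain ⟨-, S, hS, heS⟩ := Finset.mem_filter.1 heU
  refine ⟨I.constantAlgorithm S hS, I.constantAlgorithm_isOrderUnaware S hS,
    le_iInf fun π => ?_⟩
  have hcard : (Fintype.card E : ℝ≥0∞) ≠ 0 := by
    have : Nonempty E := ⟨e⟩
    simp
  rw [ENNReal.div_le_iff hcard (ENNReal.natCast_ne_top _), mul_comm, ← mul_div_assoc,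
    ENNReal.le_div_iff_mul_le (.inl (h π).1.ne') (.inl (h π).2.ne), one_mul]
  calc I.opt π ≤ ∑ e ∈ U, I.meanValue e := hopt π
    _ ≤ U.card • I.meanValue e := Finset.sum_le_card_nsmul _ _ _ hmax
    _ = U.card * I.meanValue e := nsmul_eq_mul _ _
    _ ≤ _ := by
      gcongr
      · exact Finset.card_le_univ U
      · exact I.meanValue_le_constantAlgorithm S hS heS π

/-- If all means are finite and a feasible set contains an element of positive mean, then the
benchmark is positive and finite. -/
lemma hasProperBenchmark_of_mem (S : Finset E) (hS : S ∈ I.feasible) {e : E} (he : e ∈ S)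
    (hpos : 0 < I.meanValue e) (hfin : ∀ e, I.meanValue e < ∞) : I.HasProperBenchmark := by
  refine fun π => ⟨?_, ?_⟩
  · exact (hpos.trans_le (I.meanValue_le_constantAlgorithm S hS he π)).trans_le
      (le_iSup (fun A : I.Algorithm => A.expectedUtility π) _)
  · refine (iSup_le fun A => A.expectedUtility_le_sum Finset.univ
      (fun _ _ => Finset.subset_univ _) π).trans_lt ?_
    exact ENNReal.sum_lt_top.2 fun e _ => hfin e

end General

/-! ### Bernoulli values -/

/-- The law of a random variable that is `1` with probability `p` and `0` otherwise. -/
noncomputable def bernoulliLaw (p : ℝ≥0) : Measure ℝ≥0 :=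
  (1 - p : ℝ≥0∞) • Measure.dirac 0 + (p : ℝ≥0∞) • Measure.dirac 1

lemma bernoulliLaw_isProb {p : ℝ≥0} (hp : p ≤ 1) : IsProbabilityMeasure (bernoulliLaw p) := by
  constructor
  simp [bernoulliLaw, tsub_add_cancel_of_le (ENNReal.coe_le_one_iff.2 hp)]

lemma lintegral_bernoulliLaw (p : ℝ≥0) : ∫⁻ a, (a : ℝ≥0∞) ∂bernoulliLaw p = p := by
  simp [bernoulliLaw, lintegral_smul_measure]

lemma bernoulliLaw_ne_zero (p : ℝ≥0) : bernoulliLaw p {a | a ≠ 0} = p := by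
  simp [bernoulliLaw]

lemma support_bernoulliLaw {p : ℝ≥0} (hp : 0 < p) (hp1 : p < 1) :
    (bernoulliLaw p).support = {0, 1} := by
  ext a
  rw [Measure.mem_support_iff_forall]
  constructor
  · intro h
    by_contra ha
    have hU : ({0, 1} : Set ℝ≥0)ᶜ ∈ nhds a :=
      (Set.toFinite {(0 : ℝ≥0), 1}).isClosed.isOpen_compl.mem_nhds ha
    have := h _ hU
    simp [bernoulliLaw] at this
  · rintro (rfl | rfl) U hU
    · simp [bernoulliLaw, mem_of_mem_nhds hU, hp1]
    · simp [bernoulliLaw, mem_of_mem_nhds hU, hp]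

end SelectionInstance

/-! ### The hard instance and its arrival orders -/

namespace SelectionInstance

/-- Every ranking of the elements is nondecreasing along some arrival order. -/
lemma exists_monotone_arrivalOrder {E : Type} [Fintype E] (f : E → ℕ) :
    ∃ π : ArrivalOrder E, Monotone (f ∘ π) :=
  ⟨(Tuple.sort (f ∘ (Fintype.equivFin E).symm)).trans (Fintype.equivFin E).symm,
    Tuple.monotone_sort (f ∘ (Fintype.equivFin E).symm)⟩

/-- The ground set of the hard instance: `k` password elements, signature elements indexed by a
position of the password, a bit and a position of a codeword, and `m` valuable elements. -/
abbrev HardElem (k m : ℕ) : Type := Fin k ⊕ (Fin k × Bool × Fin k) ⊕ Fin m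

namespace HardElem

variable {k m : ℕ}

abbrev password (i : Fin k) : HardElem k m := Sum.inl i

abbrev signature (i : Fin k) (c : Bool) (j : Fin k) : HardElem k m := Sum.inr (Sum.inl (i, c, j))

abbrev valuable (h : Fin m) : HardElem k m := Sum.inr (Sum.inr h)

/-- The phase in which an element arrives in the base order. -/
def stage : HardElem k m → ℕ
  | Sum.inl _ => 0
  | Sum.inr (Sum.inl (_, c, _)) => if c then 3 else 1
  | Sum.inr (Sum.inr _) => 2

/-- Exchange the two signature blocks at the positions where `x` is `true`. -/
def twistFun (x : Fin k → Bool) : HardElem k m → HardElem k m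
  | Sum.inl i => password i
  | Sum.inr (Sum.inl (i, c, j)) => signature i (xor (x i) c) j
  | Sum.inr (Sum.inr h) => valuable h

lemma twistFun_involutive (x : Fin k → Bool) :
    Function.Involutive (twistFun (m := m) x) := by
  rintro (i | ⟨i, c, j⟩ | h) <;> simp [twistFun]

/-- The arrival order obtained from `π₀` by exchanging signature blocks according to `x`. -/
def twistedOrder (π₀ : ArrivalOrder (HardElem k m)) (x : Fin k → Bool) :
    ArrivalOrder (HardElem k m) :=
  π₀.trans (twistFun_involutive x).toPerm

lemma twistedOrder_apply (π₀ : ArrivalOrder (HardElem k m)) (x : Fin k → Bool) (t) :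
    twistedOrder π₀ x t = twistFun x (π₀ t) := rfl

lemma twistedOrder_symm_apply (π₀ : ArrivalOrder (HardElem k m)) (x : Fin k → Bool) (e) :
    (twistedOrder π₀ x).symm e = π₀.symm (twistFun x e) := rfl

/-- The position of an element in the twisted order is the base position of its twisted image, so
the stage of that image decides precedence. -/
lemma twistedOrder_symm_lt {π₀ : ArrivalOrder (HardElem k m)} (hπ₀ : Monotone (stage ∘ π₀))
    (x : Fin k → Bool) {e e' : HardElem k m} (h : stage (twistFun x e) < stage (twistFun x e')) :
    (twistedOrder π₀ x).symm e < (twistedOrder π₀ x).symm e' := by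
  by_contra hle
  have := hπ₀ (not_lt.1 hle)
  simp only [Function.comp, twistedOrder_symm_apply, Equiv.apply_symm_apply] at this
  omega

/-- All twisted orders begin with the password elements in the same order. -/
lemma twistedOrder_eq_of_le {π₀ : ArrivalOrder (HardElem k m)} (hπ₀ : Monotone (stage ∘ π₀))
    (x : Fin k → Bool) (i : Fin k) {s} (hs : s ≤ π₀.symm (password i)) :
    π₀ s = twistedOrder π₀ x s := by
  have h := hπ₀ hs
  simp only [Function.comp, Equiv.apply_symm_apply] at h
  rw [twistedOrder_apply]
  rcases hπ : π₀ s with i' | ⟨i', c, j⟩ | h'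
  · rfl
  · rw [hπ] at h
    cases c <;> simp [stage] at h
  · rw [hπ] at h
    simp [stage] at h

/-- The probability that an element has value one. -/
def prob (p q : ℝ≥0) : HardElem k m → ℝ≥0
  | Sum.inl _ => q
  | Sum.inr (Sum.inl _) => q
  | Sum.inr (Sum.inr _) => p

end HardElem

open HardElem

/-- A set is feasible if it contains no valuable element, or if it contains exactly one valuable
element `h`, no signature element `(i, c, j)` where `c` is the bit chosen at the password position
`i`, and where `c` is the other bit exactly those with `code h j`. -/
noncomputable def hardInstance {k m : ℕ} (code : Fin m → Fin k → Bool) (p q : ℝ≥0) (hp : p ≤ 1)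
    (hq : q ≤ 1) : SelectionInstance (HardElem k m) where
  dist e := bernoulliLaw (prob p q e)
  isProb := by
    rintro (_ | _ | _) <;> exact bernoulliLaw_isProb (by assumption)
  feasible := {S | ∀ h, valuable h ∈ S → (∀ h', valuable h' ∈ S → h' = h) ∧
    ∀ i c j, signature i c j ∈ S ↔ (¬(c = true ↔ password i ∈ S) ∧ code h j = true)}
  feasible_nonempty := ⟨∅, by simp⟩

section Hard

variable {k m : ℕ} {code : Fin m → Fin k → Bool} {p q : ℝ≥0} {hp : p ≤ 1} {hq : q ≤ 1}

lemma hardInstance_meanValue (e : HardElem k m) :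
    (hardInstance code p q hp hq).meanValue e = prob p q e :=
  lintegral_bernoulliLaw _

lemma hardInstance_isBinary (hp0 : 0 < p) (hp1 : p < 1) (hq0 : 0 < q) (hq1 : q < 1) :
    (hardInstance code p q hp hq).IsBinary := by
  rintro (_ | _ | _) <;> apply support_bernoulliLaw <;> assumption

lemma hardInstance_hasProperBenchmark (hq0 : 0 < q) (hk : 0 < k) :
    (hardInstance code p q hp hq).HasProperBenchmark := by
  refine hasProperBenchmark_of_mem _ {password ⟨0, hk⟩} ?_ (Finset.mem_singleton_self _) ?_ ?_
  · intro h hh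
    simp at hh
  · rw [hardInstance_meanValue]
    exact_mod_cast hq0
  · intro e
    rw [hardInstance_meanValue]
    exact ENNReal.coe_lt_top

/-- Of two distinct codewords one is nonzero; its valuable element is feasible with its signature
but not alone. -/
lemma hardInstance_not_isDownwardClosed (hcode : Function.Injective code) (hm : 2 ≤ m) :
    ¬ (hardInstance code p q hp hq).IsDownwardClosed := by
  classical
  intro hdc
  obtain ⟨h, j, hj⟩ : ∃ h j, code h j = true := by
    by_contra! hno
    have : code ⟨0, by omega⟩ = code ⟨1, by omega⟩ := by
      funext j
      rw [Bool.eq_false_iff.2 (hno _ j), Bool.eq_false_iff.2 (hno _ j)]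
    simpa using hcode this
  let S : Finset (HardElem k m) := Finset.univ.filter fun e =>
    match e with
    | Sum.inl _ => False
    | Sum.inr (Sum.inl (_, c, j)) => c = true ∧ code h j = true
    | Sum.inr (Sum.inr h') => h' = h
  have hS : S ∈ (hardInstance code p q hp hq).feasible := by
    intro h₁ hh₁
    have : h₁ = h := by simpa [S] using hh₁
    subst this
    simp [S]
  have hT := hdc S hS {valuable h} (by simp [S]) h (by simp)
  -- The codeword index `j` doubles as a password position; the password here is all `false`, so bit
  -- `true` is the opposite one.
  have := (hT.2 j true j).2
  simp [hj] at this

/-- Under an order in which `e` arrives before `e'`, the decision on `e` does not depend on the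
value of `e'`. -/
lemma Algorithm.mem_select_congr {E : Type} [Fintype E] {I : SelectionInstance E}
    (A : I.Algorithm) (π : ArrivalOrder E) {e e' : E} (hlt : π.symm e < π.symm e') (ω : A.Seed)
    (v w : E → ℝ≥0) (hvw : ∀ e'', e'' ≠ e' → v e'' = w e'') :
    e ∈ A.select ω π v ↔ e ∈ A.select ω π w := by
  have := A.online ω π v w (π.symm e) fun s hs => hvw _ ?_
  · simpa using this
  · rintro rfl
    simp only [Equiv.symm_apply_apply] at hlt
    exact absurd hs (not_le.2 hlt)

/-! ### Upper bound for order-unaware algorithms -/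

section OrderUnaware

variable (A : (hardInstance code p q hp hq).Algorithm) (π₀ : ArrivalOrder (HardElem k m))

/-- The event that the password chosen by the algorithm is `x`. -/
def passwordEvent (x : Fin k → Bool) : Set (A.Seed × (HardElem k m → ℝ≥0)) :=
  {z | ∀ i, password i ∈ A.select z.1 π₀ z.2 ↔ x i = true}

/-- The event that the chosen password differs from `x` and that the decisions on the early
signature elements at the wrong positions leave only the valuable element `h`. -/
def decodeEvent (x : Fin k → Bool) (h : Fin m) : Set (A.Seed × (HardElem k m → ℝ≥0)) :=
  {z | z ∉ passwordEvent A π₀ x ∧ ∀ i j, ¬(password i ∈ A.select z.1 π₀ z.2 ↔ x i = true) →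
    (signature i (x i) j ∈ A.select z.1 (twistedOrder π₀ x) z.2 ↔ code h j = true)}

lemma measurableSet_passwordEvent (x : Fin k → Bool) : MeasurableSet (passwordEvent A π₀ x) := by
  have (i : Fin k) := (measurableSet_setOfPred.1 (A.measurable_select π₀ (password i)))
  exact measurableSet_setOfPred.2 (Measurable.forall fun i => (this i).iff measurable_const)

lemma measurableSet_decodeEvent (x : Fin k → Bool) (h : Fin m) :
    MeasurableSet (decodeEvent A π₀ x h) := by
  have h₁ (i : Fin k) := (measurableSet_setOfPred.1 (A.measurable_select π₀ (password i)))
  have h₂ (i j : Fin k) := (measurableSet_setOfPred.1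
    (A.measurable_select (twistedOrder π₀ x) (signature i (x i) j)))
  refine (measurableSet_passwordEvent A π₀ x).compl.inter (measurableSet_setOfPred.2 ?_)
  exact Measurable.forall fun i => Measurable.forall fun j =>
    ((h₁ i).iff measurable_const).not.imp ((h₂ i j).iff measurable_const)

variable {A π₀}

lemma disjoint_passwordEvent {x x' : Fin k → Bool} (hx : x ≠ x') :
    Disjoint (passwordEvent A π₀ x) (passwordEvent A π₀ x') := by
  rw [Set.disjoint_left]
  refine fun z hz hz' => hx (funext fun i => Bool.eq_iff_iff.2 ?_)
  exact (hz i).symm.trans (hz' i)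

/-- A wrong position depends only on the outcome, not on `h`; the block there spells a single
codeword. -/
lemma disjoint_decodeEvent (hcode : Function.Injective code) (x : Fin k → Bool) {h h' : Fin m}
    (hh : h ≠ h') : Disjoint (decodeEvent A π₀ x h) (decodeEvent A π₀ x h') := by
  rw [Set.disjoint_left]
  refine fun z hz hz' => hh (hcode (funext fun j => Bool.eq_iff_iff.2 ?_))
  obtain ⟨i, hi⟩ := not_forall.1 hz.1
  exact (hz.2 i j hi).symm.trans (hz'.2 i j hi)

lemma passwordEvent_congr (hπ₀ : Monotone (stage ∘ π₀)) (x : Fin k → Bool) (h : Fin m)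
    (ω : A.Seed) (v w : HardElem k m → ℝ≥0) (hvw : ∀ e, e ≠ valuable h → v e = w e) :
    (ω, v) ∈ passwordEvent A π₀ x ↔ (ω, w) ∈ passwordEvent A π₀ x := by
  refine forall_congr' fun i => iff_congr (A.mem_select_congr π₀ ?_ ω v w hvw) Iff.rfl
  by_contra hle
  have := hπ₀ (not_lt.1 hle)
  simp [stage] at this

/-- All decisions involved precede the valuable elements: the twist sends the bit `x i` to `false`,
the early stage. Hence the event is independent of the value of `h`. -/
lemma decodeEvent_congr (hπ₀ : Monotone (stage ∘ π₀)) (x : Fin k → Bool) (h : Fin m)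
    (ω : A.Seed) (v w : HardElem k m → ℝ≥0) (hvw : ∀ e, e ≠ valuable h → v e = w e) :
    (ω, v) ∈ decodeEvent A π₀ x h ↔ (ω, w) ∈ decodeEvent A π₀ x h := by
  refine and_congr (not_congr (passwordEvent_congr hπ₀ x h ω v w hvw))
    (forall_congr' fun i => forall_congr' fun j => imp_congr (not_congr (iff_congr ?_ Iff.rfl))
      (iff_congr ?_ Iff.rfl))
  · refine A.mem_select_congr π₀ ?_ ω v w hvw
    by_contra hle
    have := hπ₀ (not_lt.1 hle)
    simp [stage] at this
  · exact A.mem_select_congr _ (twistedOrder_symm_lt hπ₀ x (by simp [twistFun, stage])) ω v w hvw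

lemma password_mem_select_twistedOrder (hA : A.IsOrderUnaware) (hπ₀ : Monotone (stage ∘ π₀))
    (x : Fin k → Bool) (i : Fin k) (ω : A.Seed) (v : HardElem k m → ℝ≥0) :
    password i ∈ A.select ω (twistedOrder π₀ x) v ↔ password i ∈ A.select ω π₀ v := by
  have := hA ω π₀ (twistedOrder π₀ x) v v (π₀.symm (password i)) fun s hs =>
    ⟨twistedOrder_eq_of_le hπ₀ x i hs, rfl⟩
  simpa using this.symm

/-- A valuable element can only be selected if the password is right or the early signature
elements identify it. -/
lemma mem_passwordEvent_or_decodeEvent (hA : A.IsOrderUnaware) (hπ₀ : Monotone (stage ∘ π₀))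
    (x : Fin k → Bool) (z : A.Seed × (HardElem k m → ℝ≥0))
    (hz : A.select z.1 (twistedOrder π₀ x) z.2 ∈ (hardInstance code p q hp hq).feasible)
    {h : Fin m} (hh : valuable h ∈ A.select z.1 (twistedOrder π₀ x) z.2) :
    z ∈ passwordEvent A π₀ x ∨ z ∈ decodeEvent A π₀ x h := by
  by_cases hP : z ∈ passwordEvent A π₀ x
  · exact .inl hP
  refine .inr ⟨hP, fun i j hij => ?_⟩
  rw [(hz h hh).2 i (x i) j, password_mem_select_twistedOrder hA hπ₀]
  tauto

lemma expectedUtility_twistedOrder_le (hcode : Function.Injective code) (hA : A.IsOrderUnaware)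
    (hπ₀ : Monotone (stage ∘ π₀)) (x : Fin k → Bool) :
    A.expectedUtility (twistedOrder π₀ x) ≤ (k + k * (2 * k) : ℕ) * (q : ℝ≥0∞) + p +
      m * p * (A.seedLaw.prod (hardInstance code p q hp hq).valueLaw) (passwordEvent A π₀ x) := by
  classical
  let I := hardInstance code p q hp hq
  let μ := A.seedLaw.prod I.valueLaw
  have hval (e : HardElem k m) :
      Measurable fun z : A.Seed × (HardElem k m → ℝ≥0) => (z.2 e : ℝ≥0∞) :=
    measurable_coe_nnreal_ennreal.comp ((measurable_pi_apply e).comp measurable_snd)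
  let P : A.Seed × (HardElem k m → ℝ≥0) → ℝ≥0∞ := (passwordEvent A π₀ x).indicator 1
  let D (h : Fin m) : A.Seed × (HardElem k m → ℝ≥0) → ℝ≥0∞ :=
    (decodeEvent A π₀ x h).indicator 1
  have hP : Measurable P := measurable_one.indicator (measurableSet_passwordEvent A π₀ x)
  have hD (h) : Measurable (D h) := measurable_one.indicator (measurableSet_decodeEvent A π₀ x h)
  -- A pointwise majorant of the utility: cheap elements are counted always, a valuable one only on
  -- events independent of its value.
  let g : HardElem k m → A.Seed × (HardElem k m → ℝ≥0) → ℝ≥0∞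
    | Sum.inl i => fun z => z.2 (password i)
    | Sum.inr (Sum.inl s) => fun z => z.2 (Sum.inr (Sum.inl s))
    | Sum.inr (Sum.inr h) => fun z => z.2 (valuable h) * P z + z.2 (valuable h) * D h z
  have hg : ∀ e, Measurable (g e) := by
    rintro (i | s | h)
    · exact hval _
    · exact hval _
    · exact ((hval _).mul hP).add ((hval _).mul (hD h))
  -- Disjointness makes wrong guesses contribute p in total rather than mp.
  have hdisj : ∑ h, μ (decodeEvent A π₀ x h) ≤ 1 := by
    rw [← measure_univ (μ := μ)]
    exact sum_measure_le_measure_univ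
      (fun h _ => (measurableSet_decodeEvent A π₀ x h).nullMeasurableSet)
      fun h _ h' _ hne => (disjoint_decodeEvent hcode x hne).aedisjoint
  calc A.expectedUtility (twistedOrder π₀ x) ≤ ∫⁻ z, ∑ e, g e z ∂μ := by
        refine lintegral_mono_ae ?_
        filter_upwards [A.select_feasible (twistedOrder π₀ x)] with z hz
        refine (Finset.sum_le_sum fun e he => ?_).trans
          (Finset.sum_le_sum_of_subset (Finset.subset_univ _))
        rcases e with i | s | h
        · exact le_rfl
        · exact le_rfl
        · rcases mem_passwordEvent_or_decodeEvent hA hπ₀ x z hz he with h' | h'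
          · simp [g, P, h']
          · simp [g, D, h']
    _ = ∑ e, ∫⁻ z, g e z ∂μ := lintegral_finsetSum _ fun e _ => hg e
    _ = (k * q + k * (2 * k) * q) +
          (m * p * μ (passwordEvent A π₀ x) + p * ∑ h, μ (decodeEvent A π₀ x h)) := by
        have h1 (i : Fin k) : ∫⁻ z, g (Sum.inl i) z ∂μ = q :=
          (I.lintegral_prod_value _ _).trans (hardInstance_meanValue _)
        have h2 (s) : ∫⁻ z, g (Sum.inr (Sum.inl s)) z ∂μ = q :=
          (I.lintegral_prod_value _ _).trans (hardInstance_meanValue _)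
        have h3 (h) : ∫⁻ z, g (Sum.inr (Sum.inr h)) z ∂μ =
            p * μ (passwordEvent A π₀ x) + p * μ (decodeEvent A π₀ x h) := by
          have hm : (p : ℝ≥0∞) = I.meanValue (valuable h) :=
            (hardInstance_meanValue (code := code) (hp := hp) (hq := hq) (valuable h)).symm
          rw [hm]
          change _ = _ * (A.seedLaw.prod I.valueLaw) _ + _ * (A.seedLaw.prod I.valueLaw) _
          rw [← I.lintegral_value_mul_indicator _ _ _
              (measurableSet_passwordEvent A π₀ x) (passwordEvent_congr hπ₀ x h),
            ← I.lintegral_value_mul_indicator _ _ _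
              (measurableSet_decodeEvent A π₀ x h) (decodeEvent_congr hπ₀ x h),
            ← lintegral_add_left (f := fun z => (z.2 (valuable h) : ℝ≥0∞) * P z)
              ((hval _).mul hP)]
        simp only [Fintype.sum_sum_type, h1, h2, h3, Finset.sum_const, Finset.card_univ,
          Fintype.card_fin, Fintype.card_prod, Fintype.card_bool, nsmul_eq_mul,
          Finset.sum_add_distrib, Finset.mul_sum, Nat.cast_mul, Nat.cast_ofNat]
        ring
    _ ≤ (k * q + k * (2 * k) * q) + (m * p * μ (passwordEvent A π₀ x) + p * 1) := by gcongr
    _ = _ := by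
        push_cast
        ring

/-- The password events all refer to the same order `π₀`, so their probabilities sum to at most 1
and mp is paid once, not 2^k times. -/
lemma sum_expectedUtility_le (hcode : Function.Injective code) (hA : A.IsOrderUnaware)
    (hπ₀ : Monotone (stage ∘ π₀)) :
    ∑ x, A.expectedUtility (twistedOrder π₀ x) ≤
      2 ^ k * ((k + k * (2 * k) : ℕ) * (q : ℝ≥0∞) + p) + m * p := by
  let I := hardInstance code p q hp hq
  have hsum : ∑ x, (A.seedLaw.prod I.valueLaw) (passwordEvent A π₀ x) ≤ 1 := by
    rw [← measure_univ (μ := A.seedLaw.prod I.valueLaw)]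
    exact sum_measure_le_measure_univ
      (fun x _ => (measurableSet_passwordEvent A π₀ x).nullMeasurableSet)
      fun x _ x' _ hne => (disjoint_passwordEvent hne).aedisjoint
  refine (Finset.sum_le_sum fun x _ => expectedUtility_twistedOrder_le hcode hA hπ₀ x).trans ?_
  rw [Finset.sum_add_distrib, ← Finset.mul_sum, Finset.sum_const]
  refine add_le_add (le_of_eq ?_) ((mul_le_mul_right hsum _).trans_eq (mul_one _))
  simp [mul_add]

end OrderUnaware

end Hard

end SelectionInstance

namespace SelectionInstance

open HardElem

/-! ### Lower bound for the order-aware optimum -/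

section Informed

variable {k m : ℕ} {code : Fin m → Fin k → Bool} {p q : ℝ≥0} {hp : p ≤ 1} {hq : q ≤ 1}

/-- `h` is the first valuable element in the order `π` whose value is not zero. -/
def IsFirstNonzero (π : ArrivalOrder (HardElem k m)) (v : HardElem k m → ℝ≥0) (h : Fin m) : Prop :=
  v (valuable h) ≠ 0 ∧
    ∀ h', π.symm (valuable h') < π.symm (valuable h) → v (valuable h') = 0

lemma IsFirstNonzero.unique {π : ArrivalOrder (HardElem k m)} {v : HardElem k m → ℝ≥0}
    {h h' : Fin m} (hh : IsFirstNonzero π v h) (hh' : IsFirstNonzero π v h') : h' = h := by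
  rcases lt_trichotomy (π.symm (valuable h')) (π.symm (valuable h)) with hlt | heq | hlt
  · exact absurd (hh.2 h' hlt) hh'.1
  · simpa using heq
  · exact absurd (hh'.2 h hlt) hh.1

lemma isFirstNonzero_congr {π : ArrivalOrder (HardElem k m)} {v w : HardElem k m → ℝ≥0}
    {h : Fin m} (hvw : ∀ s ≤ π.symm (valuable h), v (π s) = w (π s)) :
    IsFirstNonzero π v h ↔ IsFirstNonzero π w h := by
  have key : ∀ h', π.symm (valuable h') ≤ π.symm (valuable h) →
      v (valuable h') = w (valuable h') := fun h' hle => by simpa using hvw _ hle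
  unfold IsFirstNonzero
  rw [key h le_rfl]
  exact and_congr Iff.rfl (forall_congr' fun h' => imp_congr_right fun hlt => by rw [key h' hlt.le])

/-- The selection rule that announces the password `x`, selects the first valuable element with
nonzero value, and afterwards encodes this element in the late signature elements. -/
def InformedMem (code : Fin m → Fin k → Bool) (x : Fin k → Bool)
    (π : ArrivalOrder (HardElem k m)) (v : HardElem k m → ℝ≥0) : HardElem k m → Prop
  | Sum.inl i => x i = true
  | Sum.inr (Sum.inl (i, c, j)) => c ≠ x i ∧ ∃ h, IsFirstNonzero π v h ∧ code h j = true
  | Sum.inr (Sum.inr h) => IsFirstNonzero π v h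

open Classical in
/-- The set of the elements that satisfy the selection rule. -/
noncomputable def informedSet (code : Fin m → Fin k → Bool) (x : Fin k → Bool)
    (π : ArrivalOrder (HardElem k m)) (v : HardElem k m → ℝ≥0) : Finset (HardElem k m) :=
  Finset.univ.filter (InformedMem code x π v)

lemma mem_informedSet {x : Fin k → Bool} {π : ArrivalOrder (HardElem k m)}
    {v : HardElem k m → ℝ≥0} {e : HardElem k m} :
    e ∈ informedSet code x π v ↔ InformedMem code x π v e := by
  simp [informedSet]

lemma informedSet_mem_feasible (x : Fin k → Bool) (π : ArrivalOrder (HardElem k m))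
    (v : HardElem k m → ℝ≥0) :
    informedSet code x π v ∈ (hardInstance code p q hp hq).feasible := by
  intro h hh
  rw [mem_informedSet] at hh
  refine ⟨fun h' hh' => IsFirstNonzero.unique hh (mem_informedSet.1 hh'), fun i c j => ?_⟩
  rw [mem_informedSet, mem_informedSet]
  change (c ≠ x i ∧ ∃ h, IsFirstNonzero π v h ∧ code h j = true) ↔
    (¬(c = true ↔ x i = true) ∧ code h j = true)
  rw [← Bool.eq_iff_iff]
  refine and_congr Iff.rfl ⟨?_, fun hj => ⟨h, hh, hj⟩⟩
  rintro ⟨h', hh', hj⟩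
  rwa [IsFirstNonzero.unique hh hh'] at hj

lemma measurable_isFirstNonzero (π : ArrivalOrder (HardElem k m)) (h : Fin m) :
    Measurable fun v : HardElem k m → ℝ≥0 => IsFirstNonzero π v h := by
  have hz (h' : Fin m) : Measurable fun v : HardElem k m → ℝ≥0 => v (valuable h') = 0 :=
    measurableSet_setOfPred.1 (measurable_pi_apply (valuable h') (measurableSet_singleton 0))
  exact (hz h).not.and (Measurable.forall fun h' => measurable_const.imp (hz h'))

lemma measurable_informedMem (x : Fin k → Bool) (π : ArrivalOrder (HardElem k m))
    (e : HardElem k m) : Measurable fun v => InformedMem code x π v e := by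
  rcases e with i | ⟨i, c, j⟩ | h
  · exact measurable_const
  · exact measurable_const.and (Measurable.exists fun h =>
      (measurable_isFirstNonzero π h).and measurable_const)
  · exact measurable_isFirstNonzero π h

/-- A signature element with bit other than `x i` lies in the last stage, when the first nonzero
valuable element is already known. -/
lemma informedMem_congr {π₀ : ArrivalOrder (HardElem k m)} (hπ₀ : Monotone (stage ∘ π₀))
    (x : Fin k → Bool) (e : HardElem k m) {v w : HardElem k m → ℝ≥0}
    (hvw : ∀ s ≤ (twistedOrder π₀ x).symm e,
      v (twistedOrder π₀ x s) = w (twistedOrder π₀ x s)) :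
    InformedMem code x (twistedOrder π₀ x) v e ↔ InformedMem code x (twistedOrder π₀ x) w e := by
  rcases e with i | ⟨i, c, j⟩ | h
  · exact Iff.rfl
  · refine and_congr_right fun hc => exists_congr fun h =>
      and_congr_left' (isFirstNonzero_congr fun s hs => hvw s (hs.trans (le_of_lt ?_)))
    refine twistedOrder_symm_lt hπ₀ x ?_
    have : xor (x i) c = true := by
      revert hc
      cases c <;> cases x i <;> simp
    simp [twistFun, stage, this]
  · exact isFirstNonzero_congr hvw

open Classical in
/-- The order-aware algorithm for the order `twistedOrder π₀ x`. -/
noncomputable def informedAlgorithm (code : Fin m → Fin k → Bool) (p q : ℝ≥0) (hp : p ≤ 1)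
    (hq : q ≤ 1) {π₀ : ArrivalOrder (HardElem k m)} (hπ₀ : Monotone (stage ∘ π₀))
    (x : Fin k → Bool) : (hardInstance code p q hp hq).Algorithm where
  Seed := Unit
  seedSpace := inferInstance
  seedLaw := Measure.dirac ()
  seedLaw_isProb := inferInstance
  select _ π v := if π = twistedOrder π₀ x then informedSet code x (twistedOrder π₀ x) v else ∅
  measurable_select π e := by
    by_cases hπ : π = twistedOrder π₀ x
    · simp only [hπ, if_true, mem_informedSet]
      exact measurableSet_setOfPred.2 ((measurable_informedMem x _ e).comp measurable_snd)
    · simp [hπ]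
  online _ π v w t hvw := by
    by_cases hπ : π = twistedOrder π₀ x
    · subst hπ
      simp only [if_true, mem_informedSet]
      exact informedMem_congr hπ₀ x _ (by simpa using hvw)
    · simp [hπ]
  select_feasible π := .of_forall fun z => by
    by_cases hπ : π = twistedOrder π₀ x
    · simp only [hπ, if_true]
      exact informedSet_mem_feasible x _ z.2
    · simp only [hπ, if_false]
      intro h hh
      simp at hh

/-- Union bound over all m valuable elements; including `h` itself costs only a lower-order loss. -/
lemma one_sub_le_measure_forall_eq_zero {Ω : Type} [MeasurableSpace Ω] (μ : Measure Ω)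
    [IsProbabilityMeasure μ] (h : Fin m) :
    1 - (m * p : ℝ≥0) ≤ (μ.prod (hardInstance code p q hp hq).valueLaw)
      {z | ∀ h', h' ≠ h → z.2 (valuable h') = 0} := by
  let I := hardInstance code p q hp hq
  let ν := μ.prod I.valueLaw
  let B : Set (Ω × (HardElem k m → ℝ≥0)) := {z | ∀ h', h' ≠ h → z.2 (valuable h') = 0}
  have hone (h' : Fin m) : ν {z | z.2 (valuable h') ≠ 0} = p := by
    have hs : MeasurableSet {a : ℝ≥0 | a ≠ 0} := (measurableSet_singleton 0).compl
    have h1 : MeasurePreserving (Prod.snd : Ω × (HardElem k m → ℝ≥0) → _) ν I.valueLaw :=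
      measurePreserving_snd
    have h2 : MeasurePreserving (Function.eval (valuable h')) I.valueLaw
        (I.dist (valuable h')) := measurePreserving_eval I.dist (valuable h')
    rw [← bernoulliLaw_ne_zero p]
    exact (h2.comp h1).measure_preimage hs.nullMeasurableSet
  rw [tsub_le_iff_right]
  calc 1 = ν Set.univ := measure_univ.symm
    _ ≤ ν (B ∪ ⋃ h', {z | z.2 (valuable h') ≠ 0}) := by
        refine measure_mono fun z _ => ?_
        by_cases hz : z ∈ B
        · exact .inl hz
        · simp only [B, Set.mem_ofPred_eq, not_forall] at hz
          obtain ⟨h', -, hh'⟩ := hz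
          exact .inr (Set.mem_iUnion.2 ⟨h', hh'⟩)
    _ ≤ ν B + ∑ h', ν {z | z.2 (valuable h') ≠ 0} :=
        (measure_union_le _ _).trans (by gcongr; exact measure_iUnion_fintype_le _ _)
    _ = ν B + (m * p : ℝ≥0) := by simp [hone]

lemma le_opt_twistedOrder {π₀ : ArrivalOrder (HardElem k m)} (hπ₀ : Monotone (stage ∘ π₀))
    (x : Fin k → Bool) : ((m * p * (1 - m * p) : ℝ≥0) : ℝ≥0∞) ≤
      (hardInstance code p q hp hq).opt (twistedOrder π₀ x) := by
  classical
  refine le_trans ?_ (le_iSup (fun A : (hardInstance code p q hp hq).Algorithm =>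
    A.expectedUtility (twistedOrder π₀ x)) (informedAlgorithm code p q hp hq hπ₀ x))
  let I := hardInstance code p q hp hq
  let ν : Measure (Unit × (HardElem k m → ℝ≥0)) := (Measure.dirac ()).prod I.valueLaw
  -- On `B h` a nonzero `h` is the first nonzero valuable element, and `B h` does not involve its
  -- value.
  let B (h : Fin m) : Set (Unit × (HardElem k m → ℝ≥0)) :=
    {z | ∀ h', h' ≠ h → z.2 (valuable h') = 0}
  have hB (h) : MeasurableSet (B h) := by
    have hz (h' : Fin m) :
        Measurable fun z : Unit × (HardElem k m → ℝ≥0) => z.2 (valuable h') = 0 :=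
      measurableSet_setOfPred.1
        (((measurable_pi_apply (valuable h')).comp measurable_snd) (measurableSet_singleton 0))
    exact measurableSet_setOfPred.2 (Measurable.forall fun h' => measurable_const.imp (hz h'))
  have hm (h : Fin m) : I.meanValue (valuable h) = p := hardInstance_meanValue _
  have hterm (h : Fin m) : (p * (1 - m * p) : ℝ≥0) ≤
      ∫⁻ z, (z.2 (valuable h) : ℝ≥0∞) * (B h).indicator 1 z ∂ν := by
    rw [I.lintegral_value_mul_indicator _ (valuable h) (B h) (hB h), hm, ENNReal.coe_mul,
      ENNReal.coe_sub, ENNReal.coe_one]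
    · gcongr
      exact one_sub_le_measure_forall_eq_zero _ h
    · refine fun ω v w hvw => forall_congr' fun h' => imp_congr_right fun hne => ?_
      change v (valuable h') = 0 ↔ w (valuable h') = 0
      rw [hvw (valuable h') (by simpa using hne)]
  calc ((m * p * (1 - m * p) : ℝ≥0) : ℝ≥0∞) = ∑ h : Fin m, ((p * (1 - m * p) : ℝ≥0) : ℝ≥0∞) := by
        simp [mul_assoc]
    _ ≤ ∑ h : Fin m, ∫⁻ z, (z.2 (valuable h) : ℝ≥0∞) * (B h).indicator 1 z ∂ν :=
        Finset.sum_le_sum fun h _ => hterm h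
    _ = ∫⁻ z, ∑ h : Fin m, (z.2 (valuable h) : ℝ≥0∞) * (B h).indicator 1 z ∂ν := by
        rw [lintegral_finsetSum]
        exact fun h _ => (measurable_coe_nnreal_ennreal.comp
          ((measurable_pi_apply (valuable h)).comp measurable_snd)).mul
          (measurable_one.indicator (hB h))
    _ ≤ ∫⁻ z, ∑ e ∈ informedSet code x (twistedOrder π₀ x) z.2, (z.2 e : ℝ≥0∞) ∂ν := by
        refine lintegral_mono fun z => ?_
        rw [informedSet, Finset.sum_filter, Fintype.sum_sum_type, Fintype.sum_sum_type]
        refine le_trans (Finset.sum_le_sum fun h _ => ?_) (le_add_self.trans le_add_self)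
        by_cases hz : z ∈ B h
        · by_cases hv : z.2 (valuable h) = 0
          · simp [hv]
          · have : InformedMem code x (twistedOrder π₀ x) z.2 (valuable h) :=
              ⟨hv, fun h' hlt => hz h' (by rintro rfl; exact lt_irrefl _ hlt)⟩
            simp [hz, this]
        · simp [hz]
    _ = _ := by
        simp only [Algorithm.expectedUtility, informedAlgorithm, if_true]
        rfl

/-- The averaging argument over all passwords. -/
lemma mul_le_of_le_orderCompetitiveRatio (hcode : Function.Injective code)
    (hI : (hardInstance code p q hp hq).HasProperBenchmark)
    (A : (hardInstance code p q hp hq).Algorithm) (hA : A.IsOrderUnaware) {c : ℝ≥0}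
    (hc : c ≤ A.orderCompetitiveRatio) :
    2 ^ k * (c * (m * p * (1 - m * p))) ≤ 2 ^ k * ((k + k * (2 * k) : ℕ) * q + p) + m * p := by
  obtain ⟨π₀, hπ₀⟩ := exists_monotone_arrivalOrder (stage (k := k) (m := m))
  have key (x : Fin k → Bool) :
      ((c * (m * p * (1 - m * p)) : ℝ≥0) : ℝ≥0∞) ≤ A.expectedUtility (twistedOrder π₀ x) := by
    have h1 := hI (twistedOrder π₀ x)
    have h2 := hc.trans (iInf_le _ (twistedOrder π₀ x))
    rw [ENNReal.le_div_iff_mul_le (.inl h1.1.ne') (.inl h1.2.ne)] at h2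
    rw [ENNReal.coe_mul]
    exact le_trans (by gcongr; exact le_opt_twistedOrder hπ₀ x) h2
  have := (Finset.sum_le_sum fun x _ => key x).trans (sum_expectedUtility_le hcode hA hπ₀)
  rw [Finset.sum_const, nsmul_eq_mul] at this
  simp only [Finset.card_univ, Fintype.card_pi, Fintype.card_bool, Finset.prod_const,
    Fintype.card_fin] at this
  exact_mod_cast this

end Informed

/-! ### Choice of parameters -/

open Filter Topology in
/-- Polylogarithmically many password and signature elements are negligible. -/
lemma tendsto_log_sq_div :
    Tendsto (fun n : ℕ => (10 * (Nat.log 2 n + 1 : ℝ) ^ 2) / n) atTop (𝓝 0) := by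
  have h1 : Tendsto (fun s : ℕ => (s : ℝ) ^ 2 / 2 ^ s) atTop (𝓝 0) :=
    tendsto_pow_const_div_const_pow_of_one_lt 2 one_lt_two
  have hlog : Tendsto (fun n : ℕ => Nat.log 2 n + 1) atTop atTop := by
    refine tendsto_atTop_mono (fun n => Nat.le_succ _) ?_
    refine tendsto_atTop_atTop.2 fun b => ⟨2 ^ b, fun n hn => ?_⟩
    exact Nat.le_log_of_pow_le one_lt_two hn
  have h2 := (h1.comp hlog).const_mul 20
  rw [mul_zero] at h2
  refine squeeze_zero' (.of_forall fun n => by positivity) ?_ h2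
  filter_upwards [eventually_gt_atTop 0] with n hn
  have hpow : (2 : ℝ) ^ Nat.log 2 n ≤ n := by exact_mod_cast Nat.pow_log_le_self 2 hn.ne'
  simp only [Function.comp, Nat.cast_add, Nat.cast_one]
  calc (10 * (Nat.log 2 n + 1 : ℝ) ^ 2) / n
      ≤ (10 * (Nat.log 2 n + 1 : ℝ) ^ 2) / 2 ^ Nat.log 2 n := by
        gcongr
    _ = _ := by
        rw [pow_succ]
        field_simp
        ring

open Filter Topology in
-- The summand 2 in the first condition leaves room for two valuable elements, as the failure of
-- downward closure needs.
lemma eventually_parameters (ξ : ℝ) (hξ : 1 < ξ) :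
    ∀ᶠ n : ℕ in atTop, 10 * (Nat.log 2 n + 1) ^ 2 + 2 ≤ n ∧
      1 + 2 / (n : ℝ) < ξ * (1 - 10 * (Nat.log 2 n + 1 : ℝ) ^ 2 / n) * (1 - 1 / n) := by
  have h1 (c : ℝ) : Tendsto (fun n : ℕ => c / (n : ℝ)) atTop (𝓝 0) :=
    tendsto_const_div_atTop_nhds_zero_nat c
  have hsum := tendsto_log_sq_div.add (h1 2)
  rw [add_zero] at hsum
  have hL : Tendsto (fun n : ℕ => 1 + 2 / (n : ℝ)) atTop (𝓝 (1 + 0)) := (h1 2).const_add 1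
  have hR : Tendsto (fun n : ℕ => ξ * (1 - 10 * (Nat.log 2 n + 1 : ℝ) ^ 2 / n) * (1 - 1 / n))
      atTop (𝓝 (ξ * (1 - 0) * (1 - 0))) :=
    ((tendsto_log_sq_div.const_sub 1).const_mul ξ).mul ((h1 1).const_sub 1)
  filter_upwards [hsum.eventually_le_const one_pos,
    hL.eventually_lt hR (by linarith), eventually_gt_atTop 0] with n hn hlt hpos
  refine ⟨?_, hlt⟩
  rw [← add_div, div_le_one (by exact_mod_cast hpos)] at hn
  exact_mod_cast hn

/-- The averaging bound contradicts a ratio of `ξ / n`, for `L` password and signature elements,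
`m` valuable elements and `M` passwords. -/
lemma parameters_contradiction {ξ n m M L l : ℝ} (hξ : 0 < ξ) (hn : 1 ≤ n) (hM : n ^ 2 ≤ M)
    (hL0 : 0 ≤ L) (hL : L ≤ l) (hln : l ≤ n) (hm : m = n - L)
    (hlt : 1 + 2 / n < ξ * (1 - l / n) * (1 - 1 / n))
    (h : M * (ξ / n * (m * (1 / n ^ 2) * (1 - m * (1 / n ^ 2)))) ≤
      M * (L * (1 / n ^ 4) + 1 / n ^ 2) + m * (1 / n ^ 2)) : False := by
  have hn0 : 0 < n := by linarith
  have hM0 : 0 < M := lt_of_lt_of_le (by positivity) hM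
  have hm0 : 0 ≤ m := by linarith
  have hmn : m ≤ n := by linarith
  have h1 : ξ * (1 - l / n) * (1 - 1 / n) ≤
      n ^ 2 * (ξ / n * (m * (1 / n ^ 2) * (1 - m * (1 / n ^ 2)))) := by
    have e : n ^ 2 * (ξ / n * (m * (1 / n ^ 2) * (1 - m * (1 / n ^ 2)))) =
        ξ * (m / n) * (1 - m / n ^ 2) := by
      field_simp
    have a : 1 - l / n ≤ m / n := by
      rw [hm, sub_div, div_self hn0.ne']
      gcongr
    have b : 1 - 1 / n ≤ 1 - m / n ^ 2 := by
      have : m / n ^ 2 ≤ n / n ^ 2 := by gcongr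
      have e2 : n / n ^ 2 = 1 / n := by field_simp
      linarith
    have c : 0 ≤ 1 - 1 / n := by
      rw [sub_nonneg, div_le_one hn0]
      exact hn
    rw [e]
    gcongr
  -- The main term is p = 1/n²; cheap elements and lucky guesses add at most 1/n³ each.
  have h2 : L * (1 / n ^ 4) + 1 / n ^ 2 + m * (1 / n ^ 2) / M ≤ (1 + 2 / n) / n ^ 2 := by
    have a : L * (1 / n ^ 4) ≤ n * (1 / n ^ 4) := by gcongr; linarith
    have b : m * (1 / n ^ 2) / M ≤ n * (1 / n ^ 2) / n ^ 2 := by gcongr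
    have e : (1 + 2 / n) / n ^ 2 = n * (1 / n ^ 4) + 1 / n ^ 2 + n * (1 / n ^ 2) / n ^ 2 := by
      field_simp
      ring
    linarith
  have h3 : ξ / n * (m * (1 / n ^ 2) * (1 - m * (1 / n ^ 2))) ≤
      L * (1 / n ^ 4) + 1 / n ^ 2 + m * (1 / n ^ 2) / M := by
    rw [← mul_le_mul_iff_right₀ hM0]
    calc _ ≤ _ := h
      _ = _ := by field_simp
  have h4 := h3.trans h2
  rw [le_div_iff₀ (by positivity), mul_comm] at h4
  linarith

theorem exists_hard_instance (ξ : ℝ) (hξ : 1 < ξ) : ∃ n₀ : ℕ, ∀ n : ℕ, n₀ ≤ n →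
    ∃ (E : Type) (_ : Fintype E) (I : SelectionInstance E),
      Fintype.card E = n ∧ I.IsBinary ∧ ¬ I.IsDownwardClosed ∧ I.HasProperBenchmark ∧
      ∀ A : I.Algorithm, A.IsOrderUnaware →
        A.orderCompetitiveRatio ≤ ENNReal.ofReal (ξ / n) := by
  obtain ⟨n₀, hn₀⟩ := Filter.eventually_atTop.1 (eventually_parameters ξ hξ)
  refine ⟨n₀, fun n hn => ?_⟩
  obtain ⟨hcard, hlt⟩ := hn₀ n hn
  set s := Nat.log 2 n with hs
  -- Since n < 2^(s+1), this gives n² ≤ 2^k: enough passwords to make guessing negligible, and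
  -- enough codewords.
  obtain ⟨k, hk⟩ : ∃ k, k = 2 * (s + 1) := ⟨_, rfl⟩
  have hL : k + k * (2 * k) ≤ 10 * (s + 1) ^ 2 := by
    subst hk
    nlinarith
  obtain ⟨m, hm⟩ : ∃ m, k + k * (2 * k) + m = n := ⟨n - (k + k * (2 * k)), by omega⟩
  have hpow : n ^ 2 ≤ 2 ^ k := by
    rw [hk, mul_comm, pow_mul]
    exact Nat.pow_le_pow_left (Nat.lt_pow_succ_log_self one_lt_two n).le 2
  have hn2 : 2 ≤ n := by omega
  obtain ⟨code⟩ : Nonempty (Fin m ↪ (Fin k → Bool)) := by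
    refine Function.Embedding.nonempty_of_card_le ?_
    simp only [Fintype.card_fin, Fintype.card_pi, Fintype.card_bool, Finset.prod_const,
      Finset.card_univ]
    nlinarith
  have hnpos : (0 : ℝ≥0) < n := by exact_mod_cast (by omega : 0 < n)
  have hn1 : (1 : ℝ≥0) < n := by exact_mod_cast hn2
  have hp0 (j : ℕ) : (0 : ℝ≥0) < 1 / n ^ j := by positivity
  have hp1 (j : ℕ) (hj : j ≠ 0) : (1 : ℝ≥0) / n ^ j < 1 := by
    rw [div_lt_one (by positivity)]
    exact one_lt_pow₀ hn1 hj
  have hI := hardInstance_hasProperBenchmark (code := code) (hp := (hp1 2 two_ne_zero).le)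
    (hq := (hp1 4 four_ne_zero).le) (hp0 4) (by omega : 0 < k)
  refine ⟨HardElem k m, inferInstance,
    -- With p = 1/n², mp ≤ 1/n makes two nonzero valuable elements rare; q = 1/n⁴ keeps all other
    -- elements together below 1/n³.
    hardInstance code (1 / n ^ 2) (1 / n ^ 4) (hp1 2 two_ne_zero).le (hp1 4 four_ne_zero).le,
    ?_, hardInstance_isBinary (hp0 2) (hp1 2 two_ne_zero) (hp0 4) (hp1 4 four_ne_zero),
    hardInstance_not_isDownwardClosed code.injective (by omega), hI, fun A hA => ?_⟩
  · simp [← hm]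
    ring
  by_contra hlarge
  have key := mul_le_of_le_orderCompetitiveRatio code.injective hI A hA (not_le.1 hlarge).le
  -- Needed to read the truncated difference 1 - mp as a real one.
  have hmn : (m : ℝ≥0) * (1 / n ^ 2) ≤ 1 := by
    rw [mul_one_div, div_le_one (by positivity)]
    exact_mod_cast (by nlinarith : m ≤ n ^ 2)
  rw [← NNReal.coe_le_coe] at key
  push_cast [NNReal.coe_sub hmn] at key
  rw [Real.coe_toNNReal _ (by positivity)] at key
  refine parameters_contradiction (n := n) (m := m) (M := 2 ^ k)
    (L := (k : ℝ) + k * (2 * k)) (l := 10 * (s + 1 : ℝ) ^ 2) (by linarith) ?_ ?_ ?_ ?_ ?_ ?_ hlt key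
  · exact_mod_cast (by omega : 1 ≤ n)
  · exact_mod_cast hpow
  · positivity
  · exact_mod_cast hL
  · exact_mod_cast (by omega : 10 * (s + 1) ^ 2 ≤ n)
  · rw [eq_sub_iff_add_eq']
    exact_mod_cast hm

end SelectionInstance

theorem theorem4p1 :
    (∀ ξ : ℝ, 1 < ξ → ∃ n₀ : ℕ, ∀ n : ℕ, n₀ ≤ n →
      ∃ (E : Type) (_ : Fintype E) (I : SelectionInstance E),
        Fintype.card E = n ∧ I.IsBinary ∧ ¬ I.IsDownwardClosed ∧ I.HasProperBenchmark ∧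
        ∀ A : I.Algorithm, A.IsOrderUnaware →
          A.orderCompetitiveRatio ≤ ENNReal.ofReal (ξ / n)) ∧
    (∀ (E : Type) [Fintype E] (I : SelectionInstance E), I.HasProperBenchmark →
      ∃ A : I.Algorithm, A.IsOrderUnaware ∧
        1 / (Fintype.card E : ℝ≥0∞) ≤ A.orderCompetitiveRatio) :=
  ⟨SelectionInstance.exists_hard_instance, fun _ _ I h => I.exists_orderUnaware_inv_card_le h⟩
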